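/- Let $R$ be a Riesz space (real vector lattice) with a strong unit $1$, i.e. for every $f\in R$ there is $n\in\mathbb N$ with $|f|\le n\cdot 1$; $R$ need not be Archimedean. For $a\in R$ put $\|a\|=\inf\{q\ge 0 : |a|\le q\cdot 1\}$, and write $a\in(p,q)$ for the element $(a-p\cdot 1)\wedge(q\cdot 1-a)$ of $R$. Let $\Sigma$ be the spectrum of $R$: the locale whose frame of opens is presented by generators $D(a)$, $a\in R$, subject to the relations $D(a)=0$ if $a\le 0$; $D(1)=\top$; $D(a)\wedge D(-a)=0$; $D(a+b)\le D(a)\vee D(b)$; $D(a\vee b)=D(a)\vee D(b)$; $D(a)=\bigvee_{s>0}D(a-s\cdot 1)$. Let $\mathrm{Loc}(\Sigma,\mathbb R)$ be the set of locale maps $\Sigma\to\mathbb R$, i.e. of frame maps from the frame of opens of $\mathbb R$ to the frame of opens of $\Sigma$. It is a Riesz space, with operations obtained by composing with the continuous operations of $\mathbb R$ (and $f\le g$ iff $f\vee g=g$), and it contains the constant map $1$. Theorem (Localic Stone–Yosida). The constant map $1$ is a strong unit of $\mathrm{Loc}(\Sigma,\mathbb R)$, so that $\|f\|=\inf\{q\ge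 0: |f|\le q\cdot 1\}$ is defined there as well. There is a map $\hat{\cdot}:R\to\mathrm{Loc}(\Sigma,\mathbb R)$ such that for each $a \in R$ the frame map $\hat a$ is given on open intervals by $\hat a\big((p,q)\big)=D\big(a\in(p,q)\big)$ for all $p,q\in\mathbb R$. This map is a Riesz morphism (it is linear and preserves $\vee$ and $\wedge$) with $\hat 1=1$, and it is norm-preserving: $\|\hat a\|=\|a\|$ for all $a\in R$. Its image is dense in the uniform topology on $\mathrm{Loc}(\Sigma,\mathbb R)$, in which the sets $\{g : |g-f|\le\varepsilon\cdot 1\}$, $\varepsilon>0$, form a base of neighbourhoods of $f$. -/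

import Mathlib

open TopologicalSpace

noncomputable section

namespace StoneYosida

universe u v w

/-! ### Strong units and the norm of a Riesz space with unit -/

/-- `e` is a (strong) unit: every `|f|` is bounded by a natural multiple of `e`. -/
def IsStrongUnit {V : Type*} [AddCommGroup V] [Lattice V] (e : V) : Prop :=
  ∀ f : V, ∃ n : ℕ, |f| ≤ n • e

/-- The norm `‖a‖ = inf {q ≥ 0 | |a| ≤ q e}` given by a strong unit `e`. -/
def unitNorm {V : Type*} [AddCommGroup V] [Lattice V] [Module ℝ V] (e a : V) : ℝ :=
  sInf {q : ℝ | 0 ≤ q ∧ |a| ≤ q • e}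

/-! ### Frames presented by generators and relations -/

/-- The free frame on a set `G` of generators: the lower sets of the free meet-semilattice on `G`,
which consists of the finite subsets of `G` (finite formal meets) under reverse inclusion. -/
abbrev FreeFrame (G : Type u) : Type u := LowerSet (Finset G)ᵒᵈ

/-- The generator `g` of the free frame: all finite formal meets in which `g` occurs. -/
def FreeFrame.gen {G : Type u} (g : G) : FreeFrame G where
  carrier := {F | g ∈ OrderDual.ofDual F}
  lower' := fun _ _ hab ha => hab ha

/-- The quotient of a frame `F` by the relations `u = v` for `rel u v`, realised as the set of
saturated elements `x`, those with `c ⊓ u ≤ x ↔ c ⊓ v ≤ x` for all `c` whenever `rel u v`. The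
quotient map is `(presented rel).restrict : FrameHom F (presented rel)`. -/
def presented {F : Type u} [Order.Frame F] (rel : F → F → Prop) : Sublocale F where
  carrier := {x | ∀ u v, rel u v → u ⇨ x = v ⇨ x}
  sInf_mem' := by
    intro s hs u v huv
    refine eq_of_forall_le_iff fun c => ?_
    rw [le_himp_iff, le_himp_iff, le_sInf_iff, le_sInf_iff]
    refine forall_congr' fun b => forall_congr' fun hb => ?_
    rw [← le_himp_iff, ← le_himp_iff, hs hb u v huv]
  himp_mem' := by
    intro a b hb u v huv
    rw [himp_left_comm u a b, himp_left_comm v a b, hb u v huv]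

/-! ### The spectrum locale -/

section Spectrum

variable {R : Type u} [AddCommGroup R] [Lattice R] [Module ℝ R]

open FreeFrame in
/-- The defining relations of the spectrum of a Riesz space `R` with unit `e` on the generators
`D(a)`, `a ∈ R`. An inequality `u ≤ v` is written `u ⊔ v = v`. -/
inductive SpectrumRel (e : R) : FreeFrame R → FreeFrame R → Prop
  | nonpos (a : R) (ha : a ≤ 0) : SpectrumRel e (gen a) ⊥
  | unit : SpectrumRel e (gen e) ⊤
  | disj (a : R) : SpectrumRel e (gen a ⊓ gen (-a)) ⊥
  | add (a b : R) : SpectrumRel e (gen (a + b) ⊔ (gen a ⊔ gen b)) (gen a ⊔ gen b)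
  | sup (a b : R) : SpectrumRel e (gen (a ⊔ b)) (gen a ⊔ gen b)
  | cont (a : R) : SpectrumRel e (gen a) (⨆ (s : ℝ) (_ : 0 < s), gen (a - s • e))

/-- The spectrum locale `Σ` of `(R, e)`, given as its frame of opens. -/
abbrev Spectrum (e : R) : Type u := ↥(presented (SpectrumRel e))

/-- The open `D(a)` of the spectrum. -/
def Spectrum.D (e a : R) : Spectrum e := (presented (SpectrumRel e)).restrict (FreeFrame.gen a)

end Spectrum

/-! ### Pairing of locale maps into spaces

A locale map from the locale `L` to (the locale of) a space `X` is a frame map `Opens X → L`. -/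

section Pairing

variable {X : Type v} {Y : Type w} [TopologicalSpace X] [TopologicalSpace Y]
  {L : Type u} [Order.Frame L]

/-- The value at the open set `O` of the pairing of `f` and `g`: the join of all `f(V) ∧ g(W)`
with `V × W ⊆ O`. -/
def pairFun (f : FrameHom (Opens X) L) (g : FrameHom (Opens Y) L) (O : Opens (X × Y)) : L :=
  sSup {c | ∃ (V : Opens X) (W : Opens Y), (∀ x ∈ V, ∀ y ∈ W, (x, y) ∈ O) ∧ c = f V ⊓ g W}

theorem le_pairFun {f : FrameHom (Opens X) L} {g : FrameHom (Opens Y) L} {O : Opens (X × Y)}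
    (V : Opens X) (W : Opens Y) (h : ∀ x ∈ V, ∀ y ∈ W, (x, y) ∈ O) :
    f V ⊓ g W ≤ pairFun f g O := le_sSup ⟨V, W, h, rfl⟩

theorem pairFun_mono (f : FrameHom (Opens X) L) (g : FrameHom (Opens Y) L)
    {O O' : Opens (X × Y)} (h : O ≤ O') : pairFun f g O ≤ pairFun f g O' := by
  refine sSup_le ?_
  rintro _ ⟨V, W, hVW, rfl⟩
  exact le_pairFun V W fun x hx y hy => h (hVW x hx y hy)

theorem pairFun_sSup_le [LocallyCompactSpace Y] (f : FrameHom (Opens X) L)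
    (g : FrameHom (Opens Y) L) (S : Set (Opens (X × Y))) (V : Opens X) (W : Opens Y)
    (h : ∀ x ∈ V, ∀ y ∈ W, (x, y) ∈ sSup S) : f V ⊓ g W ≤ sSup (pairFun f g '' S) := by
  set s := sSup (pairFun f g '' S) with hs
  -- `W` is the union of the opens contained in a compact subset of `W`
  have hW : W = sSup {W' : Opens Y | ∃ K : Set Y, IsCompact K ∧ (W' : Set Y) ⊆ K ∧ K ⊆ W} := by
    apply le_antisymm
    · intro y hy
      obtain ⟨K, hK, hyK, hKW⟩ := exists_compact_subset W.isOpen hy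
      exact Opens.mem_sSup.2 ⟨⟨interior K, isOpen_interior⟩, ⟨K, hK, interior_subset, hKW⟩, hyK⟩
    · refine sSup_le ?_
      rintro W' ⟨K, _, h1, h2⟩
      exact h1.trans h2
  rw [hW, map_sSup, inf_sSup_eq]
  refine iSup₂_le ?_
  rintro _ ⟨W', ⟨K, hK, hW'K, hKW⟩, rfl⟩
  -- tube argument
  have tube : ∀ x ∈ V, ∃ A : Opens X, x ∈ A ∧ f A ⊓ g W' ≤ s := by
    intro x hx
    have key : ∃ A : Opens X, x ∈ A ∧ ∃ B : Opens Y, K ⊆ B ∧ f A ⊓ g B ≤ s := by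
      refine hK.induction_on
        (p := fun K' => ∃ A : Opens X, x ∈ A ∧ ∃ B : Opens Y, K' ⊆ B ∧ f A ⊓ g B ≤ s) ?_ ?_ ?_ ?_
      · exact ⟨⊤, trivial, ⊥, Set.empty_subset _, by rw [map_bot, inf_bot_eq]; exact bot_le⟩
      · rintro K₁ K₂ h12 ⟨A, hA, B, hB, hAB⟩
        exact ⟨A, hA, B, h12.trans hB, hAB⟩
      · rintro K₁ K₂ ⟨A₁, hA₁, B₁, hB₁, h₁⟩ ⟨A₂, hA₂, B₂, hB₂, h₂⟩
        refine ⟨A₁ ⊓ A₂, ⟨hA₁, hA₂⟩, B₁ ⊔ B₂, ?_, ?_⟩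
        · rw [Opens.coe_sup]
          exact Set.union_subset_union hB₁ hB₂
        · rw [map_inf, map_sup, inf_sup_left]
          exact sup_le ((inf_le_inf_right _ inf_le_left).trans h₁)
            ((inf_le_inf_right _ inf_le_right).trans h₂)
      · intro y hy
        obtain ⟨O, hO, hxyO⟩ := Opens.mem_sSup.1 (h x hx y (hKW hy))
        obtain ⟨A, B, hA, hB, hxA, hyB, hAB⟩ := isOpen_prod_iff.1 O.isOpen x y hxyO
        refine ⟨B, mem_nhdsWithin_of_mem_nhds (hB.mem_nhds hyB), ⟨A, hA⟩, hxA, ⟨B, hB⟩,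
          subset_rfl, ?_⟩
        refine (le_pairFun (O := O) _ _ fun x hx y hy => hAB ⟨hx, hy⟩).trans ?_
        exact le_sSup ⟨O, hO, rfl⟩
    obtain ⟨A, hxA, B, hKB, hAB⟩ := key
    exact ⟨A, hxA, (inf_le_inf_left _ (OrderHomClass.mono g (hW'K.trans hKB))).trans hAB⟩
  have hV : V ≤ sSup {A : Opens X | f A ⊓ g W' ≤ s} := by
    intro x hx
    obtain ⟨A, hxA, hA⟩ := tube x hx
    exact Opens.mem_sSup.2 ⟨A, hA, hxA⟩
  refine (inf_le_inf_right _ (OrderHomClass.mono f hV)).trans ?_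
  rw [map_sSup, sSup_inf_eq]
  refine iSup₂_le ?_
  rintro _ ⟨A, hA, rfl⟩
  exact hA

/-- The pairing `⟨f, g⟩ : L → X × Y` of the locale maps `f : L → X` and `g : L → Y`. -/
def pair [LocallyCompactSpace Y] (f : FrameHom (Opens X) L) (g : FrameHom (Opens Y) L) :
    FrameHom (Opens (X × Y)) L where
  toFun := pairFun f g
  map_inf' := by
    intro O₁ O₂
    apply le_antisymm
    · exact le_inf (pairFun_mono f g inf_le_left) (pairFun_mono f g inf_le_right)
    · unfold pairFun
      rw [sSup_inf_sSup]
      refine iSup₂_le ?_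
      rintro ⟨_, _⟩ ⟨⟨V₁, W₁, h₁, rfl⟩, ⟨V₂, W₂, h₂, rfl⟩⟩
      refine le_trans (le_of_eq ?_) (le_pairFun (V₁ ⊓ V₂) (W₁ ⊓ W₂)
        fun x hx y hy => ⟨h₁ x hx.1 y hy.1, h₂ x hx.2 y hy.2⟩)
      rw [map_inf, map_inf, inf_inf_inf_comm]
  map_top' := by
    refine top_le_iff.1 (le_trans (le_of_eq ?_) (le_pairFun ⊤ ⊤ fun _ _ _ _ => trivial))
    rw [map_top, map_top, inf_top_eq]
  map_sSup' := by
    intro S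
    apply le_antisymm
    · refine sSup_le ?_
      rintro _ ⟨V, W, h, rfl⟩
      exact pairFun_sSup_le f g S V W h
    · refine sSup_le ?_
      rintro _ ⟨O, hO, rfl⟩
      exact pairFun_mono f g (le_sSup hO)

variable [LocallyCompactSpace Y]

theorem pair_fst (f : FrameHom (Opens X) L) (g : FrameHom (Opens Y) L) :
    (pair f g).comp (Opens.comap ContinuousMap.fst) = f := by
  ext V
  apply le_antisymm
  · refine sSup_le ?_
    rintro _ ⟨V', W', h, rfl⟩
    rcases (W' : Set Y).eq_empty_or_nonempty with hW | ⟨y, hy⟩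
    · have : W' = ⊥ := Opens.ext hW
      rw [this, map_bot, inf_bot_eq]
      exact bot_le
    · exact inf_le_left.trans (OrderHomClass.mono f fun x hx => h x hx y hy)
  · refine le_trans (le_of_eq ?_)
      (le_pairFun (f := f) (g := g) (O := Opens.comap ContinuousMap.fst V) V ⊤
        fun x hx y _ => hx)
    rw [map_top, inf_top_eq]

theorem pair_snd (f : FrameHom (Opens X) L) (g : FrameHom (Opens Y) L) :
    (pair f g).comp (Opens.comap ContinuousMap.snd) = g := by
  ext W
  apply le_antisymm
  · refine sSup_le ?_
    rintro _ ⟨V', W', h, rfl⟩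
    rcases (V' : Set X).eq_empty_or_nonempty with hV | ⟨x, hx⟩
    · have : V' = ⊥ := Opens.ext hV
      rw [this, map_bot, bot_inf_eq]
      exact bot_le
    · exact inf_le_right.trans (OrderHomClass.mono g fun y hy => h x hx y hy)
  · refine le_trans (le_of_eq ?_)
      (le_pairFun (f := f) (g := g) (O := Opens.comap ContinuousMap.snd W) ⊤ W
        fun x _ y hy => hy)
    rw [map_top, top_inf_eq]

theorem pair_comp {Z : Type*} [TopologicalSpace Z] (h : FrameHom (Opens Z) L)
    (α : C(Z, X)) (β : C(Z, Y)) :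
    pair (h.comp (Opens.comap α)) (h.comp (Opens.comap β)) =
      h.comp (Opens.comap (α.prodMk β)) := by
  ext O
  apply le_antisymm
  · refine sSup_le ?_
    rintro _ ⟨V, W, hVW, rfl⟩
    simp only [FrameHom.comp_apply]
    rw [← map_inf]
    exact OrderHomClass.mono h fun z hz => hVW _ hz.1 _ hz.2
  · have hO : Opens.comap (α.prodMk β) O ≤ sSup {U : Opens Z | ∃ (V : Opens X) (W : Opens Y),
        (∀ x ∈ V, ∀ y ∈ W, (x, y) ∈ O) ∧ U = Opens.comap α V ⊓ Opens.comap β W} := by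
      intro z hz
      obtain ⟨A, B, hA, hB, hzA, hzB, hAB⟩ := isOpen_prod_iff.1 O.isOpen (α z) (β z) hz
      exact Opens.mem_sSup.2 ⟨_, ⟨⟨A, hA⟩, ⟨B, hB⟩, fun x hx y hy => hAB ⟨hx, hy⟩, rfl⟩,
        ⟨hzA, hzB⟩⟩
    refine (OrderHomClass.mono h hO).trans ?_
    rw [map_sSup]
    refine sSup_le ?_
    rintro _ ⟨_, ⟨V, W, hVW, rfl⟩, rfl⟩
    rw [map_inf]
    exact le_pairFun (f := h.comp (Opens.comap α)) (g := h.comp (Opens.comap β)) V W hVW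

end Pairing

/-! ### The Riesz space of locale maps into the reals -/

/-- `Loc(L, ℝ)`: the locale maps from the locale `L` to the locale of reals, i.e. the frame maps
from the frame of opens of `ℝ` to `L`. -/
@[ext]
structure LocReal (L : Type u) [Order.Frame L] : Type u where
  /-- The frame map. -/
  frameMap : FrameHom (Opens ℝ) L

/-- The open interval `(p, q)`, as an element of the frame of opens of `ℝ`. -/
def openIoo (p q : ℝ) : Opens ℝ := ⟨Set.Ioo p q, isOpen_Ioo⟩

namespace LocReal

variable {L : Type u} [Order.Frame L]

/-- The composite `L → Z → ℝ` of a locale map `h` with a continuous function `α`. -/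
def push {Z : Type*} [TopologicalSpace Z] (h : FrameHom (Opens Z) L) (α : C(Z, ℝ)) : LocReal L :=
  ⟨h.comp (Opens.comap α)⟩

/-- `φ(f, g)`, the composite `L → ℝ × ℝ → ℝ` of the pairing `⟨f, g⟩` with `φ`. -/
def map₂ (φ : C(ℝ × ℝ, ℝ)) (f g : LocReal L) : LocReal L :=
  push (pair f.frameMap g.frameMap) φ

/-- `φ(f)`, the composite `L → ℝ → ℝ` of `f` with `φ`. -/
def map₁ (φ : C(ℝ, ℝ)) (f : LocReal L) : LocReal L := push f.frameMap φ

/-- The constant map with value `r`, whose inverse image of `U` is the join of all `⊤` with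
`r ∈ U`. -/
def const (r : ℝ) : LocReal L where
  frameMap :=
    { toFun := fun U => ⨆ _ : r ∈ U, (⊤ : L)
      map_inf' := by
        intro U V
        by_cases hU : r ∈ U <;> by_cases hV : r ∈ V <;> simp [hU, hV]
      map_top' := by simp
      map_sSup' := by
        intro S
        rw [sSup_image]
        simp only [Opens.mem_sSup, iSup_exists, iSup_and] }

instance : Zero (LocReal L) := ⟨const 0⟩
instance : One (LocReal L) := ⟨const 1⟩
instance : Add (LocReal L) := ⟨map₂ ⟨fun x => x.1 + x.2, by fun_prop⟩⟩
instance : Neg (LocReal L) := ⟨map₁ ⟨fun x => -x, by fun_prop⟩⟩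
instance : SMul ℝ (LocReal L) := ⟨fun c => map₁ ⟨fun x => c * x, by fun_prop⟩⟩
instance : Max (LocReal L) := ⟨map₂ ⟨fun x => max x.1 x.2, by fun_prop⟩⟩
instance : Min (LocReal L) := ⟨map₂ ⟨fun x => min x.1 x.2, by fun_prop⟩⟩

section Push

variable {Z : Type*} [TopologicalSpace Z] (h : FrameHom (Opens Z) L) (α β : C(Z, ℝ))

theorem map₂_push (φ : C(ℝ × ℝ, ℝ)) :
    map₂ φ (push h α) (push h β) = push h (φ.comp (α.prodMk β)) := by
  ext1
  change (pair (h.comp (Opens.comap α)) (h.comp (Opens.comap β))).comp (Opens.comap φ) = _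
  rw [pair_comp]
  rfl

theorem push_add : push h α + push h β = push h (α + β) := map₂_push h α β _
theorem push_sup : push h α ⊔ push h β = push h (α ⊔ β) := map₂_push h α β _
theorem push_inf : push h α ⊓ push h β = push h (α ⊓ β) := map₂_push h α β _
theorem push_neg : -push h α = push h (-α) := rfl
theorem push_smul (c : ℝ) : c • push h α = push h (c • α) := rfl

theorem push_const (r : ℝ) : const r = push h (ContinuousMap.const Z r) := by
  ext U
  change (⨆ _ : r ∈ U, (⊤ : L)) = h (Opens.comap (ContinuousMap.const Z r) U)
  by_cases hr : r ∈ U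
  · have : Opens.comap (ContinuousMap.const Z r) U = ⊤ := Opens.ext (Set.eq_univ_of_forall
      fun _ => hr)
    rw [this, map_top]
    simp [hr]
  · have : Opens.comap (ContinuousMap.const Z r) U = ⊥ := Opens.ext (Set.eq_empty_of_forall_notMem
      fun _ => hr)
    rw [this, map_bot]
    simp [hr]

theorem push_zero : (0 : LocReal L) = push h 0 := push_const h 0
theorem push_one : (1 : LocReal L) = push h 1 := push_const h 1

end Push

/-- Any three elements of `Loc(L, ℝ)` are composites of one locale map into `ℝ × ℝ × ℝ` with
three continuous functions. -/
theorem exists_push (f g k : LocReal L) :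
    ∃ (h : FrameHom (Opens (ℝ × ℝ × ℝ)) L) (α β γ : C(ℝ × ℝ × ℝ, ℝ)),
      f = push h α ∧ g = push h β ∧ k = push h γ := by
  refine ⟨pair f.frameMap (pair g.frameMap k.frameMap), ContinuousMap.fst,
    ContinuousMap.fst.comp ContinuousMap.snd, ContinuousMap.snd.comp ContinuousMap.snd, ?_, ?_, ?_⟩
  · ext1
    exact (pair_fst _ _).symm
  · ext1
    have h1 := pair_snd f.frameMap (pair g.frameMap k.frameMap)
    have h2 := pair_fst g.frameMap k.frameMap
    rw [← h1] at h2
    exact h2.symm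
  · ext1
    have h1 := pair_snd f.frameMap (pair g.frameMap k.frameMap)
    have h2 := pair_snd g.frameMap k.frameMap
    rw [← h1] at h2
    exact h2.symm

instance : AddCommGroup (LocReal L) where
  add_assoc f g k := by
    obtain ⟨h, α, β, γ, rfl, rfl, rfl⟩ := exists_push f g k
    simp only [push_add, add_assoc]
  zero_add f := by
    obtain ⟨h, α, _, _, rfl, _, _⟩ := exists_push f f f
    simp only [push_zero h, push_add, zero_add]
  add_zero f := by
    obtain ⟨h, α, _, _, rfl, _, _⟩ := exists_push f f f
    simp only [push_zero h, push_add, add_zero]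
  add_comm f g := by
    obtain ⟨h, α, β, _, rfl, rfl, _⟩ := exists_push f g g
    simp only [push_add, add_comm]
  neg_add_cancel f := by
    obtain ⟨h, α, _, _, rfl, _, _⟩ := exists_push f f f
    simp only [push_zero h, push_neg, push_add, neg_add_cancel]
  nsmul := nsmulRec
  zsmul := zsmulRec

instance : Module ℝ (LocReal L) where
  one_smul f := by
    obtain ⟨h, α, _, _, rfl, _, _⟩ := exists_push f f f
    simp only [push_smul, one_smul]
  mul_smul c d f := by
    obtain ⟨h, α, _, _, rfl, _, _⟩ := exists_push f f f
    simp only [push_smul, mul_smul]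
  smul_zero c := by
    obtain ⟨h, _⟩ := exists_push (0 : LocReal L) 0 0
    simp only [push_zero h, push_smul, smul_zero]
  smul_add c f g := by
    obtain ⟨h, α, β, _, rfl, rfl, _⟩ := exists_push f g g
    simp only [push_smul, push_add, smul_add]
  add_smul c d f := by
    obtain ⟨h, α, _, _, rfl, _, _⟩ := exists_push f f f
    simp only [push_smul, push_add, add_smul]
  zero_smul f := by
    obtain ⟨h, α, _, _, rfl, _, _⟩ := exists_push f f f
    simp only [push_smul, push_zero h, zero_smul]

/-- The lattice `Loc(L, ℝ)`, with order `f ≤ g ↔ f ⊔ g = g`. -/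
instance : Lattice (LocReal L) :=
  Lattice.mk'
    (fun f g => by
      obtain ⟨h, α, β, _, rfl, rfl, _⟩ := exists_push f g g
      simp only [push_sup, sup_comm])
    (fun f g k => by
      obtain ⟨h, α, β, γ, rfl, rfl, rfl⟩ := exists_push f g k
      simp only [push_sup, sup_assoc])
    (fun f g => by
      obtain ⟨h, α, β, _, rfl, rfl, _⟩ := exists_push f g g
      simp only [push_inf, inf_comm])
    (fun f g k => by
      obtain ⟨h, α, β, γ, rfl, rfl, rfl⟩ := exists_push f g k
      simp only [push_inf, inf_assoc])
    (fun f g => by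
      obtain ⟨h, α, β, _, rfl, rfl, _⟩ := exists_push f g g
      simp only [push_inf, push_sup, sup_inf_self])
    (fun f g => by
      obtain ⟨h, α, β, _, rfl, rfl, _⟩ := exists_push f g g
      simp only [push_inf, push_sup, inf_sup_self])

instance : IsOrderedAddMonoid (LocReal L) where
  add_le_add_left f g hfg k := by
    obtain ⟨h, α, β, γ, rfl, rfl, rfl⟩ := exists_push f g k
    rw [← sup_eq_right, push_sup] at hfg
    rw [← hfg, ← sup_eq_right]
    simp only [push_add, push_sup]
    congr 1
    ext z
    simp

instance : IsOrderedModule ℝ (LocReal L) where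
  smul_le_smul_of_nonneg_left c hc f g hfg := by
    obtain ⟨h, α, β, _, rfl, rfl, _⟩ := exists_push f g g
    rw [← sup_eq_right, push_sup] at hfg
    rw [← hfg, ← sup_eq_right]
    simp only [push_smul, push_sup]
    congr 1
    ext z
    have : c * α z ≤ c * max (α z) (β z) := mul_le_mul_of_nonneg_left (le_max_left _ _) hc
    simpa using this
  smul_le_smul_of_nonneg_right f hf c d hcd := by
    obtain ⟨h, α, _, _, rfl, _, _⟩ := exists_push f f f
    rw [push_zero h, ← sup_eq_right, push_sup] at hf
    rw [← hf, ← sup_eq_right]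
    simp only [push_smul, push_sup]
    congr 1
    ext z
    have : c * max 0 (α z) ≤ d * max 0 (α z) := mul_le_mul_of_nonneg_right hcd (le_max_left _ _)
    simpa using this

theorem zero_le_one' : (0 : LocReal L) ≤ 1 := by
  obtain ⟨h, _⟩ := exists_push (0 : LocReal L) 0 0
  rw [← sup_eq_right, push_zero h, push_one h, push_sup]
  congr 1
  ext z
  simp

/-- The uniform topology on `Loc(L, ℝ)`: the sets `{g | |g - f| ≤ ε · 1}`, `ε > 0`, form a base of
neighbourhoods of `f`. -/
@[reducible]
def uniformTopology (L : Type u) [Order.Frame L] : TopologicalSpace (LocReal L) where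
  IsOpen U := ∀ f ∈ U, ∃ ε : ℝ, 0 < ε ∧ ∀ g : LocReal L, |g - f| ≤ ε • 1 → g ∈ U
  isOpen_univ := fun _ _ => ⟨1, one_pos, fun _ _ => trivial⟩
  isOpen_inter := by
    intro U V hU hV f hf
    obtain ⟨ε, hε, h₁⟩ := hU f hf.1
    obtain ⟨δ, hδ, h₂⟩ := hV f hf.2
    refine ⟨min ε δ, lt_min hε hδ, fun g hg => ⟨h₁ g (hg.trans ?_), h₂ g (hg.trans ?_)⟩⟩
    · exact smul_le_smul_of_nonneg_right (min_le_left _ _) zero_le_one'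
    · exact smul_le_smul_of_nonneg_right (min_le_right _ _) zero_le_one'
  isOpen_sUnion := by
    intro S hS f hf
    obtain ⟨U, hU, hfU⟩ := hf
    obtain ⟨ε, hε, h⟩ := hS U hU f hfU
    exact ⟨ε, hε, fun g hg => ⟨U, hU, h g hg⟩⟩

end LocReal

end StoneYosida

end

/-!
The argument never uses points of the spectrum. Everything about the frame
presented by the `D a` is extracted from one family of saturated sets. For an additive submonoid `I`
of nonnegative elements, the finite formal meets `F` with `e ⊓ ⋀ F ≤ δ e + i` for every `δ > 0` and
some `i ∈ I` form a saturated lower set (`idealOpen_mem_presented`): each defining relation of the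
spectrum becomes an elementary inequality in `R`. Hence covers in the spectrum have witnesses in
`R` (`Spectrum.exists_le_of_D_le_sSup`), with three consequences:

* for `I = 0`: if `D b` is empty then `b ≤ δ e` for all `δ > 0` (`Spectrum.le_smul_of_D_eq_bot`);
* the spectrum is compact (`Spectrum.exists_unit_le_of_sSup_eq_top`);
* if `u ⊔ v` is everything, some `0 ≤ b ≤ e` has `D b ≤ u` and `D (e - b) ≤ v`
  (`Spectrum.exists_split`).

The map `â` sends `U` to the join of the opens `D (a ∈ (p, q))` with `(p, q) ⊆ U`. It preserves joins
by the Heine–Borel argument in `Spectrum.interval_le_of_Icc_subset`. Since the reals are regular,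
two frame maps out of their opens are equal as soon as one is below the other
(`frameHom_eq_of_le`), so that the algebraic laws for `â` need only one inequality on intervals
(`LocReal.map₂_eq`). The first consequence above gives preservation of the norm; compactness makes
every locale map into the reals bounded, hence makes `1` a strong unit.

For density, let `f` take values in `(-n, n)` and take thresholds `r j` at distance `ε`. Splitting
the covers `f > r j`, `f < r (j + 1)` gives elements `b j` of `R` for which `ε b j` lies between two
nearby ramps of height `ε` applied to `f`. The ramps are differences of truncations
`min x t`, so their sum telescopes and `-n e + ∑ ε b j` approximates `f` within `ε`
(`exists_abs_hatLinear_sub_le`).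
-/

namespace StoneYosida

universe u

/-! ### The basic opens of the spectrum -/

section Basic

variable {R : Type u} [AddCommGroup R] [Lattice R] [Module ℝ R] {e : R}

theorem restrict_eq_of_rel {F : Type u} [Order.Frame F] {rel : F → F → Prop} {u v : F}
    (h : rel u v) : (presented rel).restrict u = (presented rel).restrict v := by
  refine eq_of_forall_ge_iff fun x => ?_
  rw [(presented rel).giRestrict.gc u x, (presented rel).giRestrict.gc v x, ← himp_eq_top_iff,
    ← himp_eq_top_iff, x.2 u v h]

namespace Spectrum

theorem D_le_iff {a : R} {u : Spectrum e} : D e a ≤ u ↔ FreeFrame.gen a ≤ u.1 :=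
  (presented (SpectrumRel e)).giRestrict.gc _ _

variable (e) in
theorem D_inf_finset (F : Finset R) :
    (presented (SpectrumRel e)).restrict (LowerSet.Iic (OrderDual.toDual F)) =
      F.inf (D e) := by
  have : LowerSet.Iic (OrderDual.toDual F) = F.inf FreeFrame.gen := by
    ext H
    have : H ∈ (F.inf FreeFrame.gen : FreeFrame R) ↔ ∀ a ∈ F, a ∈ OrderDual.ofDual H := by
      rw [← LowerSet.Iic_le, Finset.le_inf_iff]
      simp only [LowerSet.Iic_le]
      rfl
    exact this.symm
  rw [this, map_finset_inf]
  rfl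

theorem D_of_nonpos {a : R} (ha : a ≤ 0) : D e a = ⊥ :=
  (restrict_eq_of_rel (SpectrumRel.nonpos a ha)).trans (map_bot _)

variable (e) in
theorem D_unit : D e e = ⊤ :=
  (restrict_eq_of_rel SpectrumRel.unit).trans (map_top _)

theorem D_inf_D_neg (a : R) : D e a ⊓ D e (-a) = ⊥ := by
  have := restrict_eq_of_rel (SpectrumRel.disj (e := e) a)
  rwa [map_inf, map_bot] at this

theorem D_add_le (a b : R) : D e (a + b) ≤ D e a ⊔ D e b := by
  have := restrict_eq_of_rel (SpectrumRel.add (e := e) a b)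
  rw [map_sup, map_sup] at this
  exact sup_eq_right.1 this

theorem D_sup (a b : R) : D e (a ⊔ b) = D e a ⊔ D e b :=
  (restrict_eq_of_rel (SpectrumRel.sup (e := e) a b)).trans (map_sup _ _ _)

theorem D_eq_iSup (a : R) : D e a = ⨆ (s : ℝ) (_ : 0 < s), D e (a - s • e) :=
  (restrict_eq_of_rel (SpectrumRel.cont (e := e) a)).trans (by simp only [map_iSup]; rfl)

theorem D_mono {a b : R} (h : a ≤ b) : D e a ≤ D e b := by
  rw [← sup_eq_right, ← D_sup, sup_eq_right.2 h]

theorem D_nsmul_le (n : ℕ) (a : R) : D e (n • a) ≤ D e a := by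
  induction n with
  | zero => rw [zero_smul, D_of_nonpos le_rfl]; exact bot_le
  | succ n ih => rw [succ_nsmul]; exact (D_add_le _ _).trans (sup_le ih le_rfl)

theorem D_sup_zero (a : R) : D e (a ⊔ 0) = D e a := by
  rw [D_sup, D_of_nonpos le_rfl, sup_bot_eq]

variable [IsOrderedAddMonoid R]

/-- Reason: `a ≤ a ⊓ b + (a - b)⁺` and `b ≤ a ⊓ b + (b - a)⁺`, while `D (a - b)` and `D (b - a)`
are disjoint. -/
theorem D_inf (a b : R) : D e (a ⊓ b) = D e a ⊓ D e b := by
  have key (a b : R) : D e a ≤ D e (a ⊓ b) ⊔ D e (a - b) := by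
    have h : a = a ⊓ b + (a - b) ⊔ 0 := by
      rw [← sub_eq_iff_eq_add', sub_eq_add_neg, neg_inf, add_sup, add_neg_cancel, sup_comm,
        ← sub_eq_add_neg]
    calc D e a = D e (a ⊓ b + (a - b) ⊔ 0) := by rw [← h]
      _ ≤ _ := D_add_le _ _
      _ = _ := by rw [D_sup_zero]
  apply le_antisymm (le_inf (D_mono inf_le_left) (D_mono inf_le_right))
  calc D e a ⊓ D e b ≤ (D e (a ⊓ b) ⊔ D e (a - b)) ⊓ (D e (a ⊓ b) ⊔ D e (b - a)) :=
        inf_le_inf (key a b) (by rw [inf_comm]; exact key b a)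
    _ = D e (a ⊓ b) := by rw [← sup_inf_left, ← neg_sub a b, D_inf_D_neg, sup_bot_eq]

variable [IsOrderedModule ℝ R]

theorem D_le_of_le_smul {a b : R} {c : ℝ} (hc : 0 ≤ c) (h : a ≤ c • b) : D e a ≤ D e b := by
  obtain ⟨n, hn⟩ := exists_nat_ge c
  calc D e a ≤ D e (n • (b ⊔ 0)) := D_mono <| calc
        a ≤ c • (b ⊔ 0) := h.trans (smul_le_smul_of_nonneg_left le_sup_left hc)
        _ ≤ (n : ℝ) • (b ⊔ 0) := smul_le_smul_of_nonneg_right hn le_sup_right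
        _ = n • (b ⊔ 0) := Nat.cast_smul_eq_nsmul ℝ n _
    _ ≤ D e (b ⊔ 0) := D_nsmul_le _ _
    _ = D e b := D_sup_zero b

theorem D_smul_unit {c : ℝ} (hc : 0 < c) : D e (c • e) = ⊤ := by
  rw [← top_le_iff, ← D_unit e]
  exact D_le_of_le_smul (inv_nonneg.2 hc.le) (by rw [inv_smul_smul₀ hc.ne'])

theorem D_inf_D_le_D_add (a b : R) : D e a ⊓ D e b ≤ D e (a + b) := by
  rw [← D_inf]
  refine D_le_of_le_smul (c := 1 / 2) (by norm_num) ?_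
  calc a ⊓ b = (1 / 2 : ℝ) • (a ⊓ b + a ⊓ b) := by
        rw [smul_add, ← add_smul, add_halves, one_smul]
    _ ≤ _ := smul_le_smul_of_nonneg_left (add_le_add inf_le_left inf_le_right) (by norm_num)

end Spectrum

end Basic

variable {R : Type u} [AddCommGroup R] [Lattice R] [IsOrderedAddMonoid R]
    [Module ℝ R] [IsOrderedModule ℝ R] {e : R}

theorem IsStrongUnit.nonneg (he : IsStrongUnit e) : 0 ≤ e := by
  obtain ⟨n, hn⟩ := he e
  rcases Nat.eq_zero_or_pos n with rfl | hpos
  · rw [zero_smul] at hn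
    exact neg_nonpos.1 ((neg_le_abs e).trans hn)
  · have h : 0 ≤ (n : ℝ) • e := by
      rw [Nat.cast_smul_eq_nsmul]; exact (abs_nonneg e).trans hn
    have := smul_nonneg (inv_nonneg.2 (Nat.cast_nonneg (α := ℝ) n)) h
    rwa [inv_smul_smul₀ (Nat.cast_ne_zero.2 hpos.ne')] at this

end StoneYosida

namespace StoneYosida

universe u

/-- The Riesz decomposition inequality `l ⊓ (a + b) ≤ (l ⊓ a)⁺ + (l ⊓ b)⁺`. -/
theorem le_posPart_inf_add {R : Type*} [AddCommGroup R] [Lattice R]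
    [IsOrderedAddMonoid R] {l a b : R} (h : l ≤ a + b) : l ≤ (l ⊓ a) ⊔ 0 + (l ⊓ b) ⊔ 0 := by
  let := AddCommGroup.toDistribLattice R
  have h0 : (0 : R) ≤ l ⊔ 0 := le_sup_right
  have hl : l ≤ l ⊔ 0 := le_sup_left
  have ha : a ≤ a ⊔ 0 := le_sup_left
  have ha0 : (0 : R) ≤ a ⊔ 0 := le_sup_right
  have hb : b ≤ b ⊔ 0 := le_sup_left
  have hb0 : (0 : R) ≤ b ⊔ 0 := le_sup_right
  rw [sup_inf_right, sup_inf_right, inf_add, add_inf, add_inf]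
  refine le_inf (le_inf ?_ ?_) (le_inf ?_ ?_)
  · exact hl.trans (le_add_of_nonneg_right h0)
  · exact hl.trans (le_add_of_nonneg_right hb0)
  · exact hl.trans (le_add_of_nonneg_left ha0)
  · exact h.trans (add_le_add ha hb)

variable {R : Type u} [AddCommGroup R] [Lattice R] [IsOrderedAddMonoid R]
    [Module ℝ R] [IsOrderedModule ℝ R] {e : R}

/-! ### Saturated sets from ideals -/

/-- For a set `I` of nonnegative elements closed under addition, the finite formal meets `F` such
that `e ⊓ ⋀ F` is, up to every `δ e`, dominated by an element of `I`. The meet `⋀ F` is represented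
by the lower bounds of `F`. -/
def idealOpen (e : R) (I : AddSubmonoid R) : FreeFrame R where
  carrier := {F | ∀ δ : ℝ, 0 < δ → ∃ i ∈ I, ∀ l ≤ e,
    (∀ a ∈ OrderDual.ofDual F, l ≤ a) → l ≤ δ • e + i}
  lower' := fun F F' h hF δ hδ => by
    obtain ⟨i, hi, H⟩ := hF δ hδ
    exact ⟨i, hi, fun l hl hlF => H l hl fun a ha => hlF a (h ha)⟩

theorem FreeFrame.le_himp_iff_forall {G : Type u} {c u x : FreeFrame G} :
    c ≤ u ⇨ x ↔ ∀ F ∈ c, F ∈ u → F ∈ x := by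
  rw [le_himp_iff]
  exact ⟨fun h F hc hu => h ⟨hc, hu⟩, fun h F hF => h F hF.1 hF.2⟩

open Classical in
theorem idealOpen_mem_presented (he : IsStrongUnit e) {I : AddSubmonoid R}
    (hI : ∀ i ∈ I, 0 ≤ i) : idealOpen e I ∈ presented (SpectrumRel e) := by
  let := AddCommGroup.toDistribLattice R
  have he0 := he.nonneg
  have pos : ∀ (δ : ℝ), 0 < δ → ∀ i ∈ I, 0 ≤ δ • e + i := fun δ hδ i hi =>
    add_nonneg (smul_nonneg hδ.le he0) (hI i hi)
  -- a lower set containing `F` contains every formal meet `a ⊓ F`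
  have ins (c : FreeFrame R) (F : (Finset R)ᵒᵈ) (hF : F ∈ c) (a : R) :
      OrderDual.toDual (insert a (OrderDual.ofDual F)) ∈ c :=
    c.lower (show _ ≤ F from Finset.subset_insert _ _) hF
  have hins (F : (Finset R)ᵒᵈ) (a : R) :
      OrderDual.toDual (insert a (OrderDual.ofDual F)) ∈ FreeFrame.gen a :=
    Finset.mem_insert_self _ _
  have split (δ ε : ℝ) (hδ : 0 < δ) (i j : R) (hi : i ∈ I) (hj : j ∈ I) (l a b : R)
      (ha : l ⊓ a ≤ δ • e + i) (hb : l ⊓ b ≤ δ • e + j) (hε : 2 * δ = ε) (h : l ≤ a + b) :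
      l ≤ ε • e + (i + j) := by
    refine (le_posPart_inf_add h).trans ((add_le_add (sup_le ha (pos δ hδ i hi))
      (sup_le hb (pos δ hδ j hj))).trans_eq ?_)
    rw [← hε, two_mul, add_smul]
    abel
  intro u v huv
  refine eq_of_forall_le_iff fun c => ?_
  rw [FreeFrame.le_himp_iff_forall, FreeFrame.le_himp_iff_forall]
  cases huv with
  | nonpos a ha =>
    refine ⟨fun _ F _ h => absurd h (LowerSet.notMem_bot), fun _ F _ haF δ hδ => ?_⟩
    exact ⟨0, I.zero_mem, fun l _ hl => (hl a haF).trans (ha.trans (pos δ hδ 0 I.zero_mem))⟩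
  | unit =>
    refine ⟨fun H F hF _ δ hδ => ?_, fun H F hF _ => H F hF LowerSet.mem_top⟩
    obtain ⟨i, hi, h⟩ := H _ (ins c F hF e) (hins F e) δ hδ
    refine ⟨i, hi, fun l hle hlF => h l hle fun b hb => ?_⟩
    rcases Finset.mem_insert.1 hb with rfl | hb
    exacts [hle, hlF b hb]
  | disj a =>
    refine ⟨fun _ F _ h => absurd h (LowerSet.notMem_bot), fun _ F _ haF δ hδ => ?_⟩
    refine ⟨0, I.zero_mem, fun l _ hl => le_trans ?_ (pos δ hδ 0 I.zero_mem)⟩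
    have h2 : (2 : ℝ) • l ≤ 0 := by
      rw [two_smul, ← add_neg_cancel a]
      exact add_le_add (hl a haF.1) (hl (-a) haF.2)
    have := smul_le_smul_of_nonneg_left h2 (inv_nonneg.2 (zero_le_two (α := ℝ)))
    rwa [inv_smul_smul₀ two_ne_zero, smul_zero] at this
  | add a b =>
    refine ⟨fun H F hF h => H F hF (Or.inr h), fun H F hF h => ?_⟩
    rcases h with h | h
    swap
    · exact H F hF h
    intro δ hδ
    obtain ⟨i, hi, h1⟩ := H _ (ins c F hF a) (Or.inl (hins F a)) (δ / 2) (half_pos hδ)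
    obtain ⟨j, hj, h2⟩ := H _ (ins c F hF b) (Or.inr (hins F b)) (δ / 2) (half_pos hδ)
    refine ⟨i + j, I.add_mem hi hj, fun l hle hlF => ?_⟩
    refine split (δ / 2) δ (half_pos hδ) i j hi hj l a b
      (h1 _ (inf_le_left.trans hle) fun x hx => ?_) (h2 _ (inf_le_left.trans hle) fun x hx => ?_)
      (by ring) (hlF _ h)
    all_goals rcases Finset.mem_insert.1 hx with rfl | hx
    exacts [inf_le_right, inf_le_left.trans (hlF x hx), inf_le_right, inf_le_left.trans (hlF x hx)]
  | sup a b =>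
    refine ⟨fun H F hF h δ hδ => ?_, fun H F hF h δ hδ => ?_⟩
    · obtain ⟨i, hi, h1⟩ := H _ (ins c F hF (a ⊔ b)) (hins F _) δ hδ
      refine ⟨i, hi, fun l hle hlF => h1 l hle fun x hx => ?_⟩
      rcases Finset.mem_insert.1 hx with rfl | hx
      · exact h.elim (fun h => (hlF a h).trans le_sup_left) fun h => (hlF b h).trans le_sup_right
      · exact hlF x hx
    · obtain ⟨i, hi, h1⟩ := H _ (ins c F hF a) (Or.inl (hins F a)) δ hδ
      obtain ⟨j, hj, h2⟩ := H _ (ins c F hF b) (Or.inr (hins F b)) δ hδ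
      refine ⟨i + j, I.add_mem hi hj, fun l hle hlF => ?_⟩
      have hl : l = l ⊓ a ⊔ l ⊓ b := by rw [← inf_sup_left, inf_eq_left.2 (hlF _ h)]
      rw [hl]
      refine sup_le
        ((h1 _ (inf_le_left.trans hle) fun x hx => ?_).trans
          (add_le_add_right (le_add_of_nonneg_right (hI j hj)) _))
        ((h2 _ (inf_le_left.trans hle) fun x hx => ?_).trans
          (add_le_add_right (le_add_of_nonneg_left (hI i hi)) _))
      all_goals rcases Finset.mem_insert.1 hx with rfl | hx
      exacts [inf_le_right, inf_le_left.trans (hlF x hx), inf_le_right,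
        inf_le_left.trans (hlF x hx)]
  | cont a =>
    refine ⟨fun H F hF h δ hδ => ?_, fun H F hF h δ hδ => ?_⟩
    · simp only [LowerSet.mem_iSup_iff] at h
      obtain ⟨s, hs, h⟩ := h
      obtain ⟨i, hi, h1⟩ := H _ (ins c F hF a) (hins F _) δ hδ
      refine ⟨i, hi, fun l hle hlF => h1 l hle fun x hx => ?_⟩
      rcases Finset.mem_insert.1 hx with rfl | hx
      · exact (hlF _ h).trans (sub_le_self _ (smul_nonneg hs.le he0))
      · exact hlF x hx
    · obtain ⟨i, hi, h1⟩ := H _ (ins c F hF (a - (δ / 2) • e))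
        (by simp only [LowerSet.mem_iSup_iff]; exact ⟨δ / 2, half_pos hδ, hins F _⟩)
        (δ / 2) (half_pos hδ)
      refine ⟨i, hi, fun l hle hlF => ?_⟩
      have hsub : ∀ x : R, x - (δ / 2) • e ≤ x := fun x =>
        sub_le_self _ (smul_nonneg (half_pos hδ).le he0)
      have := h1 (l - (δ / 2) • e) ((hsub l).trans hle) fun x hx => ?_
      · rw [sub_le_iff_le_add] at this
        refine this.trans_eq ?_
        rw [add_right_comm, ← add_smul, add_halves]
      · rcases Finset.mem_insert.1 hx with rfl | hx
        · exact sub_le_sub_right (hlF a h) _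
        · exact (hsub l).trans (hlF x hx)

namespace Spectrum

/-- Covers in the spectrum are witnessed by inequalities in `R`: if `I` contains all nonnegative
elements whose opens lie in a member of `S`, then a basic open `D a` covered by `S` has `e ⊓ a`
below an element of `I`, up to every `δ e`. Reason: the saturated set `idealOpen e I` contains all
members of `S`. -/
theorem exists_le_of_D_le_sSup (he : IsStrongUnit e) {I : AddSubmonoid R} (hI : ∀ i ∈ I, 0 ≤ i)
    {S : Set (Spectrum e)} (hS : ∀ u ∈ S, ∀ a : R, 0 ≤ a → D e a ≤ u → a ∈ I)
    {a : R} (ha : D e a ≤ sSup S) {δ : ℝ} (hδ : 0 < δ) : ∃ i ∈ I, e ⊓ a ≤ δ • e + i := by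
  classical
  let x : Spectrum e := ⟨idealOpen e I, idealOpen_mem_presented he hI⟩
  have hx : sSup S ≤ x := by
    refine sSup_le fun u hu => ?_
    rw [← Subtype.coe_le_coe]
    intro F hF δ hδ
    have h1 : (OrderDual.ofDual F).inf (D e) ≤ u := by
      rw [← D_inf_finset, (presented (SpectrumRel e)).giRestrict.gc]
      exact LowerSet.Iic_le.2 hF
    -- a representative `m` of `e ⊓ ⋀ F`, whose positive part belongs to `I`
    obtain ⟨m, hm, hDm⟩ : ∃ m : R, (∀ l ≤ e, (∀ a ∈ OrderDual.ofDual F, l ≤ a) → l ≤ m) ∧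
        D e m ≤ (OrderDual.ofDual F).inf (D e) := by
      induction OrderDual.ofDual F using Finset.induction_on with
      | empty => exact ⟨e, fun l hl _ => hl, le_top⟩
      | insert a F _ ih =>
        obtain ⟨m, hm, hDm⟩ := ih
        refine ⟨a ⊓ m, fun l hl hlF => le_inf (hlF a (Finset.mem_insert_self _ _))
          (hm l hl fun b hb => hlF b (Finset.mem_insert_of_mem hb)), ?_⟩
        rw [D_inf, Finset.inf_insert]
        exact inf_le_inf_left _ hDm
    refine ⟨m ⊔ 0, hS u hu _ le_sup_right ?_, fun l hl hlF => ?_⟩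
    · rw [D_sup_zero]; exact hDm.trans h1
    · exact (hm l hl hlF).trans (le_sup_left.trans
        (le_add_of_nonneg_left (smul_nonneg hδ.le he.nonneg)))
  have h : OrderDual.toDual {a} ∈ idealOpen e I :=
    D_le_iff.1 (ha.trans hx) (show a ∈ ({a} : Finset R) from Finset.mem_singleton_self a)
  obtain ⟨i, hi, h⟩ := h δ hδ
  refine ⟨i, hi, h _ inf_le_left fun b hb => ?_⟩
  rw [Finset.mem_singleton.1 hb]
  exact inf_le_right

/-- The spectrum is compact: a cover of the whole spectrum is witnessed by an inequality `e ≤ i`. -/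
theorem exists_unit_le_of_sSup_eq_top (he : IsStrongUnit e) {I : AddSubmonoid R}
    (hI : ∀ i ∈ I, 0 ≤ i) {S : Set (Spectrum e)}
    (hS : ∀ u ∈ S, ∀ a : R, 0 ≤ a → D e a ≤ u → a ∈ I) (htop : sSup S = ⊤) :
    ∃ i ∈ I, e ≤ i := by
  obtain ⟨i, hi, h⟩ := exists_le_of_D_le_sSup he hI hS (a := e) (by rw [htop]; exact le_top)
    (one_half_pos (α := ℝ))
  refine ⟨i + i, I.add_mem hi hi, ?_⟩
  rw [inf_idem] at h
  have he2 : e = (1 / 2 : ℝ) • e + (1 / 2 : ℝ) • e := by rw [← add_smul, add_halves, one_smul]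
  have h' : (1 / 2 : ℝ) • e ≤ i := by
    nth_rw 1 [he2] at h
    exact le_of_add_le_add_left h
  rw [he2]
  exact add_le_add h' h'

/-- A basic open `D(b)` is empty only if `b` is at most infinitesimal. -/
theorem le_smul_of_D_eq_bot (he : IsStrongUnit e) {b : R} (hb : D e b = ⊥) {δ : ℝ}
    (hδ : 0 < δ) : b ≤ δ • e := by
  obtain ⟨n, hn⟩ := he b
  -- the multiple `b / (n + 1)` lies below `e`, so that its meet with `e` can be dropped
  have hb' : b ≤ ((n : ℝ) + 1) • e := by
    rw [add_smul, one_smul, Nat.cast_smul_eq_nsmul]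
    exact (le_abs_self b).trans (hn.trans (le_add_of_nonneg_right he.nonneg))
  have hpos : (0 : ℝ) < n + 1 := by positivity
  obtain ⟨i, hi, h⟩ := exists_le_of_D_le_sSup he (I := ⊥) (S := ∅)
    (fun i hi => (AddSubmonoid.mem_bot.1 hi).ge) (by simp) (a := ((n : ℝ) + 1)⁻¹ • b)
    ((D_le_of_le_smul (inv_nonneg.2 hpos.le) le_rfl).trans (by rw [hb]; exact bot_le))
    (div_pos hδ hpos)
  rw [AddSubmonoid.mem_bot.1 hi, add_zero, inf_eq_right.2] at h
  · have := smul_le_smul_of_nonneg_left h hpos.le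
    rwa [smul_inv_smul₀ hpos.ne', smul_smul, mul_div_cancel₀ _ hpos.ne'] at this
  · have := smul_le_smul_of_nonneg_left hb' (inv_nonneg.2 hpos.le)
    rwa [inv_smul_smul₀ hpos.ne'] at this

/-- Complementary covers are split by an element: if `u ⊔ v` is everything there is `0 ≤ b ≤ e`
which vanishes off `u` and equals `e` off `v`. -/
theorem exists_split (he : IsStrongUnit e) {u v : Spectrum e} (huv : u ⊔ v = ⊤) :
    ∃ b : R, 0 ≤ b ∧ b ≤ e ∧ D e b ≤ u ∧ D e (e - b) ≤ v := by
  let ideal (w : Spectrum e) : AddSubmonoid R :=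
    { carrier := {a | 0 ≤ a ∧ D e a ≤ w}
      zero_mem' := ⟨le_rfl, by rw [D_of_nonpos le_rfl]; exact bot_le⟩
      add_mem' := fun ha hb => ⟨add_nonneg ha.1 hb.1, (D_add_le _ _).trans (sup_le ha.2 hb.2)⟩ }
  obtain ⟨_, hi, hei⟩ := exists_unit_le_of_sSup_eq_top he (I := ideal u ⊔ ideal v) (S := {u, v})
    (fun i hi => by
      obtain ⟨c, hc, d, hd, rfl⟩ := AddSubmonoid.mem_sup.1 hi
      exact add_nonneg hc.1 hd.1)
    (fun w hw a ha haw => by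
      rcases hw with rfl | rfl
      · exact AddSubmonoid.mem_sup_left (S := ideal w) ⟨ha, haw⟩
      · exact AddSubmonoid.mem_sup_right (T := ideal w) ⟨ha, haw⟩)
    (by rw [sSup_pair, huv])
  obtain ⟨c, hc, d, hd, rfl⟩ := AddSubmonoid.mem_sup.1 hi
  refine ⟨c ⊓ e, le_inf hc.1 he.nonneg, inf_le_right, (D_mono inf_le_left).trans hc.2,
    le_trans (D_mono ?_) hd.2⟩
  rw [sub_inf, sub_self]
  exact sup_le (sub_le_iff_le_add'.2 hei) hd.1

end Spectrum

end StoneYosida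

namespace StoneYosida

universe u

/-! ### Frame maps out of the opens of the reals -/

section FrameMaps

variable {L : Type u} [Order.Frame L]

theorem eq_sSup_openIoo (U : Opens ℝ) :
    U = sSup {V | ∃ p q : ℝ, p < q ∧ openIoo p q ≤ U ∧ V = openIoo p q} := by
  apply le_antisymm
  · intro x hx
    obtain ⟨ε, hε, h⟩ := Metric.isOpen_iff.1 U.isOpen x hx
    rw [Real.ball_eq_Ioo] at h
    exact Opens.mem_sSup.2 ⟨_, ⟨x - ε, x + ε, by linarith, h, rfl⟩,
      show x - ε < x by linarith, show x < x + ε by linarith⟩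
  · refine sSup_le ?_
    rintro _ ⟨p, q, _, h, rfl⟩
    exact h

/-- Reason: the reals are regular. -/
theorem frameHom_eq_of_le {X : Type*} [TopologicalSpace X] [RegularSpace X]
    {f g : FrameHom (Opens X) L} (h : ∀ U, f U ≤ g U) : f = g := by
  ext U
  refine le_antisymm (h U) ?_
  -- `U` is the union of the `V` whose closure is contained in `U`
  have hU : U ≤ sSup {V : Opens X | closure (V : Set X) ⊆ U} := by
    intro x hx
    obtain ⟨V, hV, hVc, hVU⟩ := exists_mem_nhds_isClosed_subset (U.isOpen.mem_nhds hx)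
    refine Opens.mem_sSup.2 ⟨⟨interior V, isOpen_interior⟩, ?_, mem_interior_iff_mem_nhds.2 hV⟩
    exact (closure_minimal interior_subset hVc).trans hVU
  refine (OrderHomClass.mono g hU).trans ?_
  rw [map_sSup]
  refine sSup_le ?_
  rintro _ ⟨V, hV, rfl⟩
  let W : Opens X := ⟨(closure (V : Set X))ᶜ, isClosed_closure.isOpen_compl⟩
  have h1 : U ⊔ W = ⊤ := by
    refine top_le_iff.1 fun x _ => ?_
    by_cases hx : x ∈ closure (V : Set X)
    exacts [Or.inl (hV hx), Or.inr hx]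
  have h2 : V ⊓ W = ⊥ := le_bot_iff.1 fun x hx => hx.2 (subset_closure hx.1)
  calc g V = g V ⊓ (f U ⊔ f W) := by rw [← map_sup, h1, map_top, inf_top_eq]
    _ ≤ f U ⊔ g V ⊓ g W := by
      rw [inf_sup_left]
      exact sup_le_sup inf_le_right (inf_le_inf_left _ (h W))
    _ = f U := by rw [← map_inf, h2, map_bot, sup_bot_eq]

theorem LocReal.ext_of_le {f g : LocReal L}
    (h : ∀ p q, p < q → f.frameMap (openIoo p q) ≤ g.frameMap (openIoo p q)) : f = g := by
  ext1
  refine frameHom_eq_of_le fun U => ?_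
  conv_lhs => rw [eq_sSup_openIoo U]
  rw [map_sSup]
  refine sSup_le ?_
  rintro _ ⟨_, ⟨p, q, hpq, h', rfl⟩, rfl⟩
  exact (h p q hpq).trans (OrderHomClass.mono _ h')

/-- A bound on pairs of intervals is a bound on the pairing. -/
theorem pairFun_le {f g : FrameHom (Opens ℝ) L} {O : Opens (ℝ × ℝ)} {c : L}
    (h : ∀ p q r s : ℝ, p < q → r < s →
      (∀ x, p < x → x < q → ∀ y, r < y → y < s → (x, y) ∈ O) →
      f (openIoo p q) ⊓ g (openIoo r s) ≤ c) : pair f g O ≤ c := by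
  refine sSup_le ?_
  rintro _ ⟨V, W, hVW, rfl⟩
  rw [eq_sSup_openIoo V, eq_sSup_openIoo W, map_sSup, map_sSup, sSup_inf_sSup]
  refine iSup₂_le ?_
  rintro ⟨_, _⟩ ⟨⟨_, ⟨p, q, hpq, hV, rfl⟩, rfl⟩, ⟨_, ⟨r, s, hrs, hW, rfl⟩, rfl⟩⟩
  exact h p q r s hpq hrs fun x h1 h2 y h3 h4 =>
    hVW x (hV (show x ∈ Set.Ioo p q from ⟨h1, h2⟩)) y (hW (show y ∈ Set.Ioo r s from ⟨h3, h4⟩))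

/-- The open half-line `(r, ∞)`. -/
def openIoi (r : ℝ) : Opens ℝ := ⟨Set.Ioi r, isOpen_Ioi⟩

/-- The open half-line `(-∞, r)`. -/
def openIio (r : ℝ) : Opens ℝ := ⟨Set.Iio r, isOpen_Iio⟩

namespace LocReal

/-- To identify `map₂ φ f g` with `k`, it is enough to compare `k` with `f` and `g` on rectangles
whose closures `φ` maps into a closed interval. Only one inequality is needed, by regularity. -/
theorem map₂_eq {φ : C(ℝ × ℝ, ℝ)} {f g k : LocReal L}
    (h : ∀ p q r s a b : ℝ, p < q → r < s →
      (∀ x ∈ Set.Icc p q, ∀ y ∈ Set.Icc r s, φ (x, y) ∈ Set.Icc a b) →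
      f.frameMap (openIoo p q) ⊓ g.frameMap (openIoo r s) ≤ k.frameMap (openIoo a b)) :
    map₂ φ f g = k := by
  refine ext_of_le fun a b _ => pairFun_le fun p q r s hpq hrs H => h p q r s a b hpq hrs ?_
  have hcl : closure (Set.Ioo p q ×ˢ Set.Ioo r s) ⊆ φ ⁻¹' Set.Icc a b := by
    refine closure_minimal ?_ (isClosed_Icc.preimage φ.continuous)
    rintro ⟨x, y⟩ ⟨hx, hy⟩
    exact Set.Ioo_subset_Icc_self (H x hx.1 hx.2 y hy.1 hy.2)
  rw [closure_prod_eq, closure_Ioo hpq.ne, closure_Ioo hrs.ne] at hcl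
  exact fun x hx y hy => hcl (Set.mk_mem_prod hx hy)

theorem map₁_eq {φ : C(ℝ, ℝ)} {f k : LocReal L}
    (h : ∀ p q a b : ℝ, p < q → (∀ x ∈ Set.Icc p q, φ x ∈ Set.Icc a b) →
      f.frameMap (openIoo p q) ≤ k.frameMap (openIoo a b)) : map₁ φ f = k := by
  refine ext_of_le fun a b _ => ?_
  change f.frameMap (Opens.comap φ (openIoo a b)) ≤ _
  rw [eq_sSup_openIoo (Opens.comap φ (openIoo a b)), map_sSup]
  refine sSup_le ?_
  rintro _ ⟨_, ⟨p, q, hpq, hV, rfl⟩, rfl⟩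
  refine h p q a b hpq ?_
  rw [← closure_Ioo hpq.ne]
  exact closure_minimal (fun x hx => Set.Ioo_subset_Icc_self (hV hx))
    (isClosed_Icc.preimage φ.continuous)

/-- A pointwise inequality which may fail only on an open set with empty inverse image. -/
theorem push_le_push {Z : Type*} [TopologicalSpace Z] {h : FrameHom (Opens Z) L} {α β : C(Z, ℝ)}
    {W : Opens Z} (hW : h W = ⊥) (hαβ : ∀ z, β z < α z → z ∈ W) : push h α ≤ push h β := by
  rw [← sup_eq_right, push_sup]
  ext U
  have key (U V : Opens Z) (hUV : ∀ z ∈ U, z ∈ V ∨ z ∈ W) : h U ≤ h V := by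
    rw [← sup_bot_eq (h V), ← hW, ← map_sup]
    exact OrderHomClass.mono h hUV
  have hz (z : Z) : z ∈ W ∨ (α ⊔ β) z = β z := by
    by_cases hz : β z < α z
    · exact Or.inl (hαβ z hz)
    · exact Or.inr (max_eq_right (not_lt.1 hz))
  apply le_antisymm <;> refine key _ _ fun z h1 => (hz z).symm.imp_left fun h2 => ?_
  · change β z ∈ U
    rw [← h2]
    exact h1
  · change (α ⊔ β) z ∈ U
    rw [h2]
    exact h1

theorem push_le_push_of_eq_top {Z : Type*} [TopologicalSpace Z] {h : FrameHom (Opens Z) L}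
    {α β : C(Z, ℝ)} {V : Opens Z} (hV : h V = ⊤) (hαβ : ∀ z ∈ V, α z ≤ β z) :
    push h α ≤ push h β := by
  let W : Opens Z := ⟨{z | β z < α z}, isOpen_lt β.continuous α.continuous⟩
  refine push_le_push (W := W) ?_ fun z hz => hz
  rw [← inf_top_eq (h W), ← hV, ← map_inf, ← map_bot h]
  congr 1
  exact le_bot_iff.1 fun z hz => (hαβ z hz.2).not_gt hz.1

theorem push_id (f : LocReal L) : push f.frameMap (ContinuousMap.id ℝ) = f := rfl

/-- Order of `Loc(L, ℝ)` through half-lines: no threshold `r` separates `g` from above and `k` from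
below. -/
theorem le_of_forall_inf_eq_bot {g k : LocReal L}
    (h : ∀ r : ℝ, g.frameMap (openIoi r) ⊓ k.frameMap (openIio r) ≤ ⊥) : g ≤ k := by
  have hg : push (pair g.frameMap k.frameMap) ContinuousMap.fst = g :=
    LocReal.ext (pair_fst _ _)
  have hk : push (pair g.frameMap k.frameMap) ContinuousMap.snd = k :=
    LocReal.ext (pair_snd _ _)
  let W : Opens (ℝ × ℝ) := ⟨{z | z.2 < z.1}, isOpen_lt continuous_snd continuous_fst⟩
  suffices hW : pair g.frameMap k.frameMap W ≤ ⊥ by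
    have := push_le_push (α := ContinuousMap.fst) (β := ContinuousMap.snd) (le_bot_iff.1 hW)
      fun z hz => hz
    rwa [hg, hk] at this
  refine pairFun_le fun p q r s hpq hrs H => ?_
  have hsp : s ≤ p := by
    by_contra! hlt
    -- a point of `(p, q)` below a point of `(r, s)`
    obtain ⟨x, hx1, hx2⟩ := exists_between (lt_min hpq hlt)
    obtain ⟨y, hy1, hy2⟩ := exists_between (max_lt hrs (hx2.trans_le (min_le_right _ _)))
    have : y < x := H x hx1 (hx2.trans_le (min_le_left _ _)) y ((le_max_left _ _).trans_lt hy1) hy2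
    exact (((le_max_right _ _).trans_lt hy1).trans this).false
  exact (inf_le_inf (OrderHomClass.mono _ fun x hx => hx.1)
    (OrderHomClass.mono _ fun x hx => (hx.2.trans_le hsp : x < p))).trans (h p)

end LocReal

end FrameMaps

end StoneYosida

namespace StoneYosida

universe u

variable {R : Type u} [AddCommGroup R] [Lattice R] [IsOrderedAddMonoid R]
    [Module ℝ R] {e : R}

/-! ### Interval opens of the spectrum -/

namespace Spectrum

variable (e) in
/-- The open `D (a ∈ (p, q))` of the spectrum. -/
def interval (a : R) (p q : ℝ) : Spectrum e := D e ((a - p • e) ⊓ (q • e - a))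

theorem interval_eq (a : R) (p q : ℝ) :
    interval e a p q = D e (a - p • e) ⊓ D e (q • e - a) := D_inf _ _

theorem exists_interval_eq_top (he : IsStrongUnit e) (a : R) :
    ∃ n : ℝ, interval e a (-n) n = ⊤ := by
  obtain ⟨n, hn⟩ := he a
  rw [← Nat.cast_smul_eq_nsmul ℝ] at hn
  refine ⟨n + 1, ?_⟩
  rw [← top_le_iff, ← D_unit e]
  refine D_mono (le_inf ?_ ?_)
  · rw [le_sub_iff_add_le, neg_smul, add_smul, one_smul, neg_add, add_comm, add_assoc,
      neg_add_cancel, add_zero]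
    exact neg_le.1 ((neg_le_abs a).trans hn)
  · rw [le_sub_iff_add_le', add_smul, one_smul]
    exact add_le_add_left ((le_abs_self a).trans hn) e

/-- Intervals are exhausted by smaller ones. -/
theorem interval_eq_iSup (a : R) (p q : ℝ) :
    interval e a p q = ⨆ (s : ℝ) (_ : 0 < s), interval e a (p + s) (q - s) := by
  rw [interval, D_eq_iSup]
  refine iSup_congr fun s => iSup_congr fun _ => ?_
  rw [interval, inf_sub, add_smul, sub_smul, sub_sub, sub_right_comm]

theorem interval_inf_le (a : R) (p q r s : ℝ) :
    interval e a p q ⊓ interval e a r s ≤ interval e a (max p r) (min q s) := by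
  simp only [interval_eq]
  refine le_inf ?_ ?_
  · rcases max_choice p r with h | h <;> rw [h]
    exacts [inf_le_left.trans inf_le_left, inf_le_right.trans inf_le_left]
  · rcases min_choice q s with h | h <;> rw [h]
    exacts [inf_le_left.trans inf_le_right, inf_le_right.trans inf_le_right]

variable [IsOrderedModule ℝ R]

theorem D_sub_anti (he : 0 ≤ e) (a : R) {p p' : ℝ} (hp : p' ≤ p) :
    D e (a - p • e) ≤ D e (a - p' • e) :=
  D_mono (sub_le_sub_left (smul_le_smul_of_nonneg_right hp he) a)

theorem D_smul_sub_mono (he : 0 ≤ e) (a : R) {q q' : ℝ} (hq : q ≤ q') :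
    D e (q • e - a) ≤ D e (q' • e - a) :=
  D_mono (sub_le_sub_right (smul_le_smul_of_nonneg_right hq he) a)

theorem interval_mono (he : 0 ≤ e) (a : R) {p q p' q' : ℝ} (hp : p' ≤ p) (hq : q ≤ q') :
    interval e a p q ≤ interval e a p' q' := by
  rw [interval_eq, interval_eq]
  exact inf_le_inf (D_sub_anti he a hp) (D_smul_sub_mono he a hq)

theorem interval_eq_bot (he : 0 ≤ e) (a : R) {p q : ℝ} (h : q ≤ p) : interval e a p q = ⊥ := by
  rw [interval_eq, ← le_bot_iff, ← D_inf_D_neg (e := e) (a - p • e), neg_sub]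
  exact inf_le_inf_left _ (D_smul_sub_mono he a h)

theorem D_sub_sup_D_smul_sub (a : R) {r r' : ℝ} (h : r < r') :
    D e (a - r • e) ⊔ D e (r' • e - a) = ⊤ := by
  rw [← top_le_iff, ← D_smul_unit (e := e) (sub_pos.2 h)]
  refine le_trans (le_of_eq ?_) (D_add_le _ _)
  rw [sub_smul]
  congr 1
  abel

/-- Overlapping intervals cover their union. -/
theorem interval_le_sup (a : R) (p q : ℝ) {r r' : ℝ} (h : r < r') :
    interval e a p q ≤ interval e a p r' ⊔ interval e a r q := by
  simp only [interval_eq]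
  calc D e (a - p • e) ⊓ D e (q • e - a)
      = D e (a - p • e) ⊓ D e (q • e - a) ⊓ (D e (a - r • e) ⊔ D e (r' • e - a)) := by
        rw [D_sub_sup_D_smul_sub a h, inf_top_eq]
    _ ≤ _ := by
        rw [inf_sup_left, sup_comm]
        exact sup_le_sup (inf_le_inf_right _ inf_le_left)
          (le_inf inf_le_right (inf_le_left.trans inf_le_right))

/-- The Heine–Borel theorem for intervals of the spectrum, by the supremum argument: consider the
last `t` for which `a ∈ (p, t)` is covered. -/
theorem interval_le_of_Icc_subset (he : 0 ≤ e) (a : R) {p q : ℝ} {S : Set (Opens ℝ)}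
    (hS : ∀ x ∈ Set.Icc p q, ∃ O ∈ S, x ∈ O) {u : Spectrum e}
    (hu : ∀ O ∈ S, ∀ r s, openIoo r s ≤ O → interval e a r s ≤ u) : interval e a p q ≤ u := by
  rcases lt_or_ge q p with hqp | hpq
  · rw [interval_eq_bot he a hqp.le]; exact bot_le
  let T : Set ℝ := {t | t ∈ Set.Icc p q ∧ interval e a p t ≤ u}
  have hpT : p ∈ T := ⟨⟨le_rfl, hpq⟩, by rw [interval_eq_bot he a le_rfl]; exact bot_le⟩
  have hbdd : BddAbove T := ⟨q, fun t ht => ht.1.2⟩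
  have hpt : p ≤ sSup T := le_csSup hbdd hpT
  obtain ⟨O, hO, htO⟩ := hS (sSup T) ⟨hpt, csSup_le ⟨p, hpT⟩ fun t ht => ht.1.2⟩
  obtain ⟨ε, hε, hball⟩ := Metric.isOpen_iff.1 O.isOpen _ htO
  rw [Real.ball_eq_Ioo] at hball
  obtain ⟨t', ht', hlt⟩ := exists_lt_of_lt_csSup ⟨p, hpT⟩ (sub_lt_self (sSup T) hε)
  have hcov : interval e a p (sSup T + ε) ≤ u :=
    (interval_le_sup a p _ hlt).trans (sup_le ht'.2 (hu O hO _ _ hball))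
  have hm : min (sSup T + ε) q ∈ T :=
    ⟨⟨le_min (by linarith) hpq, min_le_right _ _⟩,
      (interval_mono he a le_rfl (min_le_left _ _)).trans hcov⟩
  have hq : q ≤ sSup T + ε := by
    rcases min_le_iff.1 (le_csSup hbdd hm) with h | h <;> linarith
  exact (interval_mono he a le_rfl hq).trans hcov

end Spectrum

variable [IsOrderedModule ℝ R]

open Spectrum

/-! ### The Gelfand transform -/

/-- The locale map `â` from the spectrum to the reals; the inverse image of `U` is the join of the
`D (a ∈ (p, q))` with `(p, q) ⊆ U`. -/
def hat (he : IsStrongUnit e) (a : R) : LocReal (Spectrum e) where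
  frameMap :=
    { toFun := fun U => sSup {c | ∃ p q : ℝ, openIoo p q ≤ U ∧ c = interval e a p q}
      map_inf' := by
        intro U V
        apply le_antisymm
        · refine sSup_le ?_
          rintro _ ⟨p, q, h, rfl⟩
          exact le_inf (le_sSup ⟨p, q, h.trans inf_le_left, rfl⟩)
            (le_sSup ⟨p, q, h.trans inf_le_right, rfl⟩)
        · rw [sSup_inf_sSup]
          refine iSup₂_le ?_
          rintro ⟨_, _⟩ ⟨⟨p, q, h, rfl⟩, ⟨r, s, h', rfl⟩⟩
          refine (interval_inf_le a p q r s).trans (le_sSup ⟨_, _, ?_, rfl⟩)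
          intro x hx
          obtain ⟨hp, hr⟩ := max_lt_iff.1 hx.1
          obtain ⟨hq, hs⟩ := lt_min_iff.1 hx.2
          exact ⟨h (show x ∈ Set.Ioo p q from ⟨hp, hq⟩), h' (show x ∈ Set.Ioo r s from ⟨hr, hs⟩)⟩
      map_top' := by
        obtain ⟨n, hn⟩ := exists_interval_eq_top he a
        exact top_le_iff.1 (hn.symm.le.trans (le_sSup ⟨-n, n, le_top, rfl⟩))
      map_sSup' := by
        intro S
        apply le_antisymm
        · refine sSup_le ?_
          rintro _ ⟨p, q, h, rfl⟩
          rw [interval_eq_iSup]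
          refine iSup₂_le fun s hs => ?_
          refine interval_le_of_Icc_subset he.nonneg a (S := S) (fun x hx => ?_)
            fun O hO r t hrt => ?_
          · have hx1 := hx.1
            have hx2 := hx.2
            exact Opens.mem_sSup.1 (h (show x ∈ Set.Ioo p q from ⟨by linarith, by linarith⟩))
          · have h1 : interval e a r t ≤
                sSup {c | ∃ p q : ℝ, openIoo p q ≤ O ∧ c = interval e a p q} :=
              le_sSup ⟨r, t, hrt, rfl⟩
            exact h1.trans (le_sSup ⟨O, hO, rfl⟩)
        · refine sSup_le ?_
          rintro _ ⟨O, hO, rfl⟩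
          refine sSup_le ?_
          rintro _ ⟨p, q, h, rfl⟩
          exact le_sSup ⟨p, q, h.trans (le_sSup hO), rfl⟩ }

section Hat

variable (he : IsStrongUnit e)

theorem hat_le_iff {a : R} {U : Opens ℝ} {c : Spectrum e} :
    (hat he a).frameMap U ≤ c ↔ ∀ p q : ℝ, openIoo p q ≤ U → interval e a p q ≤ c := by
  refine sSup_le_iff.trans ⟨fun h p q hpq => h _ ⟨p, q, hpq, rfl⟩, ?_⟩
  rintro h _ ⟨p, q, hpq, rfl⟩
  exact h p q hpq

theorem hat_openIoo (a : R) (p q : ℝ) :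
    (hat he a).frameMap (openIoo p q) = interval e a p q := by
  apply le_antisymm
  · refine (hat_le_iff he).2 fun r s h => ?_
    rcases le_or_gt s r with hsr | hrs
    · rw [interval_eq_bot he.nonneg a hsr]; exact bot_le
    · obtain ⟨h1, h2⟩ := (Set.Ioo_subset_Ioo_iff hrs).1 h
      exact interval_mono he.nonneg a h1 h2
  · exact (hat_le_iff he).1 le_rfl p q le_rfl

theorem hat_openIoi_le (a : R) (r : ℝ) :
    (hat he a).frameMap (openIoi r) ≤ D e (a - r • e) := by
  refine (hat_le_iff he).2 fun p q h => ?_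
  rcases le_or_gt q p with hqp | hpq
  · rw [interval_eq_bot he.nonneg a hqp]; exact bot_le
  · have hcl : closure (Set.Ioo p q) ⊆ Set.Ici r :=
      closure_minimal (fun x hx => show r ≤ x from le_of_lt (h hx)) isClosed_Ici
    rw [closure_Ioo hpq.ne] at hcl
    have hr := hcl (Set.left_mem_Icc.2 hpq.le)
    rw [interval_eq]
    exact inf_le_left.trans (D_sub_anti he.nonneg a hr)

theorem hat_openIio_le (a : R) (r : ℝ) :
    (hat he a).frameMap (openIio r) ≤ D e (r • e - a) := by
  refine (hat_le_iff he).2 fun p q h => ?_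
  rcases le_or_gt q p with hqp | hpq
  · rw [interval_eq_bot he.nonneg a hqp]; exact bot_le
  · have hcl : closure (Set.Ioo p q) ⊆ Set.Iic r :=
      closure_minimal (fun x hx => show x ≤ r from le_of_lt (h hx)) isClosed_Iic
    rw [closure_Ioo hpq.ne] at hcl
    have hr := hcl (Set.right_mem_Icc.2 hpq.le)
    rw [interval_eq]
    exact inf_le_right.trans (D_smul_sub_mono he.nonneg a hr)

theorem hat_add (a b : R) : hat he (a + b) = hat he a + hat he b := by
  refine (LocReal.map₂_eq fun p q r s A B hpq hrs H => ?_).symm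
  simp only [hat_openIoo, interval_eq]
  have h1 : A ≤ p + r := (H p ⟨le_rfl, hpq.le⟩ r ⟨le_rfl, hrs.le⟩).1
  have h2 : q + s ≤ B := (H q ⟨hpq.le, le_rfl⟩ s ⟨hrs.le, le_rfl⟩).2
  rw [inf_inf_inf_comm]
  refine inf_le_inf ((D_inf_D_le_D_add _ _).trans ?_) ((D_inf_D_le_D_add _ _).trans ?_)
  · rw [sub_add_sub_comm, ← add_smul]
    exact D_sub_anti he.nonneg _ h1
  · rw [sub_add_sub_comm, ← add_smul]
    exact D_smul_sub_mono he.nonneg _ h2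

theorem hat_sup (a b : R) : hat he (a ⊔ b) = hat he a ⊔ hat he b := by
  refine (LocReal.map₂_eq fun p q r s A B hpq hrs H => ?_).symm
  simp only [hat_openIoo, interval_eq]
  have h1 : A ≤ max p r := (H p ⟨le_rfl, hpq.le⟩ r ⟨le_rfl, hrs.le⟩).1
  have h2 : max q s ≤ B := (H q ⟨hpq.le, le_rfl⟩ s ⟨hrs.le, le_rfl⟩).2
  rw [inf_inf_inf_comm]
  refine inf_le_inf ?_ ?_
  · rcases le_max_iff.1 h1 with h | h
    · exact (inf_le_left.trans (D_sub_anti he.nonneg _ h)).trans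
        (D_mono (sub_le_sub_right le_sup_left _))
    · exact (inf_le_right.trans (D_sub_anti he.nonneg _ h)).trans
        (D_mono (sub_le_sub_right le_sup_right _))
  · rw [sub_sup, D_inf]
    exact inf_le_inf (D_smul_sub_mono he.nonneg _ ((le_max_left _ _).trans h2))
      (D_smul_sub_mono he.nonneg _ ((le_max_right _ _).trans h2))

theorem hat_unit : hat he e = 1 := by
  refine (LocReal.ext_of_le fun p q _ => iSup_le fun h => ?_).symm
  rw [hat_openIoo, interval_eq]
  have hp : e - p • e = (1 - p) • e := by rw [sub_smul, one_smul]
  have hq : q • e - e = (q - 1) • e := by rw [sub_smul, one_smul]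
  rw [hp, hq, D_smul_unit (sub_pos.2 h.1), D_smul_unit (sub_pos.2 h.2), inf_top_eq]

theorem hat_smul_of_pos {c : ℝ} (hc : 0 < c) (a : R) : hat he (c • a) = c • hat he a := by
  refine (LocReal.map₁_eq fun p q A B hpq H => ?_).symm
  simp only [hat_openIoo, interval_eq]
  have h1 : A ≤ c * p := (H p ⟨le_rfl, hpq.le⟩).1
  have h2 : c * q ≤ B := (H q ⟨hpq.le, le_rfl⟩).2
  have key (x : R) : D e x ≤ D e (c • x) :=
    D_le_of_le_smul (inv_nonneg.2 hc.le) (by rw [inv_smul_smul₀ hc.ne'])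
  refine inf_le_inf ((key _).trans ?_) ((key _).trans ?_)
  · rw [smul_sub, smul_smul]
    exact D_sub_anti he.nonneg _ h1
  · rw [smul_sub, smul_smul]
    exact D_smul_sub_mono he.nonneg _ h2

/-- The Gelfand transform as a linear map. -/
def hatLinear : R →ₗ[ℝ] LocReal (Spectrum e) where
  toFun := hat he
  map_add' := hat_add he
  map_smul' c a := by
    let f : R →+ LocReal (Spectrum e) := AddMonoidHom.mk' (hat he) (hat_add he)
    change f (c • a) = c • f a
    rcases lt_trichotomy c 0 with hc | rfl | hc
    · have h : f ((-c) • a) = (-c) • f a := hat_smul_of_pos he (neg_pos.2 hc) a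
      rwa [neg_smul, neg_smul, map_neg, neg_inj] at h
    · rw [zero_smul, zero_smul, map_zero]
    · exact hat_smul_of_pos he hc a

theorem hatLinear_apply (a : R) : hatLinear he a = hat he a := rfl

theorem hatLinear_sup (a b : R) : hatLinear he (a ⊔ b) = hatLinear he a ⊔ hatLinear he b :=
  hat_sup he a b

theorem hatLinear_inf (a b : R) : hatLinear he (a ⊓ b) = hatLinear he a ⊓ hatLinear he b := by
  rw [← neg_neg (a ⊓ b), neg_inf, map_neg, hatLinear_sup, map_neg, map_neg, neg_sup, neg_neg,
    neg_neg]

theorem hatLinear_mono {a b : R} (h : a ≤ b) : hatLinear he a ≤ hatLinear he b := by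
  rw [← sup_eq_right, ← hatLinear_sup, sup_eq_right.2 h]

theorem hatLinear_abs (a : R) : hatLinear he |a| = |hatLinear he a| := by
  rw [abs, hatLinear_sup, map_neg, abs]

theorem hatLinear_unit : hatLinear he e = 1 := hat_unit he

/-! ### The norm -/

/-- Reason: `b⁺` is sent to the constant `0`, whose inverse image of `(0, n)` is empty. -/
theorem D_eq_bot_of_hatLinear_nonpos {b : R} (h : hatLinear he b ≤ 0) : D e b = ⊥ := by
  have h0 : hatLinear he (b ⊔ 0) = 0 := by rw [hatLinear_sup, map_zero, sup_eq_right.2 h]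
  obtain ⟨n, hn⟩ := exists_interval_eq_top he (b ⊔ 0)
  have h1 : interval e (b ⊔ 0) 0 n = ⊥ := by
    rw [← hat_openIoo he, ← hatLinear_apply, h0]
    exact iSup_eq_bot.2 fun h => absurd h.1 (lt_irrefl _)
  rw [interval_eq] at hn h1
  rw [(inf_eq_top_iff.1 hn).2, inf_top_eq, zero_smul, sub_zero, D_sup_zero] at h1
  exact h1

theorem unitNorm_hatLinear (a : R) : unitNorm 1 (hatLinear he a) = unitNorm e a := by
  have key (q : ℝ) (hq : |hatLinear he a| ≤ q • 1) (ε : ℝ) (hε : 0 < ε) : |a| ≤ (q + ε) • e := by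
    have h : hatLinear he (|a| - q • e) ≤ 0 := by
      rw [map_sub, hatLinear_abs, map_smul, hatLinear_unit]
      exact sub_nonpos.2 hq
    have := le_smul_of_D_eq_bot he (D_eq_bot_of_hatLinear_nonpos he h) hε
    rw [add_smul]
    exact sub_le_iff_le_add'.1 this
  have hsub (q : ℝ) (hq : |a| ≤ q • e) : |hatLinear he a| ≤ q • 1 := by
    rw [← hatLinear_abs, ← hatLinear_unit he, ← map_smul]
    exact hatLinear_mono he hq
  have hbdd {V : Type u} [AddCommGroup V] [Lattice V] [Module ℝ V] (x y : V) :
      BddBelow {q : ℝ | 0 ≤ q ∧ |y| ≤ q • x} := ⟨0, fun q hq => hq.1⟩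
  obtain ⟨n, hn⟩ := he a
  rw [← Nat.cast_smul_eq_nsmul ℝ] at hn
  apply le_antisymm
  · exact csInf_le_csInf (hbdd _ _) ⟨n, Nat.cast_nonneg n, hn⟩ fun q hq => ⟨hq.1, hsub q hq.2⟩
  · refine le_csInf ⟨n, Nat.cast_nonneg n, hsub n hn⟩ fun q hq => ?_
    exact le_of_forall_pos_le_add fun ε hε =>
      csInf_le (hbdd _ _) ⟨add_nonneg hq.1 hε.le, key q hq.2 ε hε⟩

end Hat

end StoneYosida

namespace StoneYosida

universe u

variable {R : Type u} [AddCommGroup R] [Lattice R] [IsOrderedAddMonoid R]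
    [Module ℝ R] [IsOrderedModule ℝ R] {e : R}

open Spectrum LocReal

/-! ### Boundedness of locale maps from the spectrum to the reals -/

/-- Reason: the spectrum is compact. -/
theorem LocReal.exists_openIoo_eq_top (he : IsStrongUnit e) (f : LocReal (Spectrum e)) :
    ∃ n : ℕ, f.frameMap (openIoo (-n) n) = ⊤ := by
  have hmono : Monotone fun n : ℕ => f.frameMap (openIoo (-n) n) := fun m n hmn =>
    OrderHomClass.mono _ (Set.Ioo_subset_Ioo (neg_le_neg (Nat.cast_le.2 hmn)) (Nat.cast_le.2 hmn))
  let I : AddSubmonoid R :=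
    { carrier := {a | 0 ≤ a ∧ ∃ n : ℕ, D e a ≤ f.frameMap (openIoo (-n) n)}
      zero_mem' := ⟨le_rfl, 0, by rw [D_of_nonpos le_rfl]; exact bot_le⟩
      add_mem' := by
        rintro a b ⟨ha, m, hm⟩ ⟨hb, n, hn⟩
        exact ⟨add_nonneg ha hb, max m n, (D_add_le a b).trans (sup_le
          (hm.trans (hmono (le_max_left m n))) (hn.trans (hmono (le_max_right m n))))⟩ }
  obtain ⟨i, ⟨_, n, hn⟩, hei⟩ := exists_unit_le_of_sSup_eq_top he (I := I)
    (S := f.frameMap '' Set.range fun n : ℕ => openIoo (-n) n) (fun i hi => hi.1)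
    (by
      rintro _ ⟨_, ⟨n, rfl⟩, rfl⟩ a ha hn
      exact ⟨ha, n, hn⟩)
    (by
      rw [← map_sSup, ← map_top f.frameMap]
      congr 1
      refine top_le_iff.1 fun x _ => ?_
      obtain ⟨n, hn⟩ := exists_nat_gt |x|
      exact Opens.mem_sSup.2 ⟨_, ⟨n, rfl⟩, abs_lt.1 hn⟩)
  exact ⟨n, top_le_iff.1 ((D_unit e).ge.trans ((D_mono hei).trans hn))⟩

theorem LocReal.isStrongUnit_one (he : IsStrongUnit e) :
    IsStrongUnit (1 : LocReal (Spectrum e)) := by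
  intro f
  obtain ⟨n, hn⟩ := f.exists_openIoo_eq_top he
  refine ⟨n, ?_⟩
  rw [← Nat.cast_smul_eq_nsmul ℝ, ← push_id f, abs, push_neg, push_sup, push_one f.frameMap,
    push_smul]
  refine push_le_push_of_eq_top hn fun x hx => ?_
  have : |x| ≤ n := (abs_lt.2 hx).le
  simpa [abs] using this

/-! ### Density -/

theorem LocReal.push_sub {L : Type*} [Order.Frame L] {Z : Type*} [TopologicalSpace Z]
    (h : FrameHom (Opens Z) L) (α β : C(Z, ℝ)) : push h α - push h β = push h (α - β) := by
  rw [sub_eq_add_neg, push_neg, push_add, sub_eq_add_neg]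

/-- Truncation of the reals at `t`. The ramp from `0` at `s` to `t - s` at `t` is
`truncate t - truncate s`. -/
def truncate (t : ℝ) : C(ℝ, ℝ) := ⟨fun x => min x t, by fun_prop⟩

theorem truncate_apply (t x : ℝ) : truncate t x = min x t := rfl

theorem LocReal.openIoi_inf_openIio {L : Type*} [Order.Frame L] (f : LocReal L) (r : ℝ) :
    f.frameMap (openIoi r) ⊓ f.frameMap (openIio r) = ⊥ := by
  rw [← map_inf, ← map_bot f.frameMap]
  congr 1
  exact le_bot_iff.1 fun x hx => lt_asymm (show r < x from hx.1) hx.2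

theorem LocReal.openIoi_sup_openIio {L : Type*} [Order.Frame L] (f : LocReal L) {r r' : ℝ}
    (h : r < r') : f.frameMap (openIoi r) ⊔ f.frameMap (openIio r') = ⊤ := by
  rw [← map_sup, ← map_top f.frameMap]
  congr 1
  exact top_le_iff.1 fun x _ => lt_or_ge r x |>.imp id fun hx => hx.trans_lt h

section Density

variable (he : IsStrongUnit e) {f : LocReal (Spectrum e)} {b : R} {r η : ℝ}

/-- If `b ≤ e` vanishes off `f > r`, then `η b` lies below the ramp of `f` that has reached `η` at
`r`. -/
theorem hatLinear_le_ramp (hη : 0 < η) (hbe : b ≤ e) (hb : D e b ≤ f.frameMap (openIoi r)) :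
    hatLinear he (η • b) ≤ push f.frameMap (truncate r - truncate (r - η)) := by
  refine le_of_forall_inf_eq_bot fun t => ?_
  have h1 := hat_openIoi_le he (η • b) t
  rcases lt_or_ge t 0 with ht | ht
  · refine inf_le_right.trans ((OrderHomClass.mono f.frameMap fun x hx => ?_).trans
      (map_bot f.frameMap).le)
    have hx : min x r - min x (r - η) < t := hx
    have : min x (r - η) ≤ min x r := min_le_min_left _ (by linarith)
    linarith
  rcases lt_or_ge t η with htη | htη
  · refine (inf_le_inf (h1.trans (le_trans ?_ hb)) ?_).trans
      (f.openIoi_inf_openIio r).le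
    · refine D_le_of_le_smul hη.le (sub_le_self _ (smul_nonneg ht he.nonneg))
    · refine OrderHomClass.mono f.frameMap fun x hx => ?_
      have hx : min x r - min x (r - η) < t := hx
      change x < r
      by_contra! hrx
      rw [min_eq_right hrx, min_eq_right (by linarith)] at hx
      linarith
  · refine inf_le_left.trans (h1.trans (D_of_nonpos ?_).le)
    exact sub_nonpos.2 ((smul_le_smul_of_nonneg_left hbe hη.le).trans
      (smul_le_smul_of_nonneg_right htη he.nonneg))

/-- If `b ≥ 0` equals `e` off `f < r`, then `η b` lies above the ramp of `f` that starts at `r`. -/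
theorem ramp_le_hatLinear (hη : 0 < η) (hb0 : 0 ≤ b)
    (hb : D e (e - b) ≤ f.frameMap (openIio r)) :
    push f.frameMap (truncate (r + η) - truncate r) ≤ hatLinear he (η • b) := by
  refine le_of_forall_inf_eq_bot fun t => ?_
  have h1 := hat_openIio_le he (η • b) t
  rcases le_or_gt t 0 with ht | ht
  · refine inf_le_right.trans (h1.trans (D_of_nonpos ?_).le)
    exact sub_nonpos.2 ((smul_nonpos_of_nonpos_of_nonneg ht he.nonneg).trans
      (smul_nonneg hη.le hb0))
  rcases lt_or_ge t η with htη | htη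
  · refine (inf_le_inf ?_ (h1.trans (le_trans ?_ hb))).trans (f.openIoi_inf_openIio r).le
    · refine OrderHomClass.mono f.frameMap fun x hx => ?_
      have hx : t < min x (r + η) - min x r := hx
      change r < x
      by_contra! hrx
      rw [min_eq_left hrx, min_eq_left (by linarith)] at hx
      linarith
    · refine D_le_of_le_smul hη.le ?_
      rw [smul_sub]
      exact sub_le_sub_right (smul_le_smul_of_nonneg_right htη.le he.nonneg) _
  · refine inf_le_left.trans ((OrderHomClass.mono f.frameMap fun x hx => ?_).trans
      (map_bot f.frameMap).le)
    have hx : t < min x (r + η) - min x r := hx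
    rcases le_total x r with h | h
    · rw [min_eq_left h, min_eq_left (by linarith)] at hx
      linarith
    · rw [min_eq_right h] at hx
      have := min_le_right x (r + η)
      linarith

/-- Every locale map `f` from the spectrum to the reals is uniformly approximated by
`-n e + ε ∑ b j`, where `b j` splits the cover of the spectrum by `f > r j` and `f < r (j + 1)` for
equidistant thresholds `r j` with distance `ε`. -/
theorem exists_abs_hatLinear_sub_le (f : LocReal (Spectrum e)) {ε : ℝ} (hε : 0 < ε) :
    ∃ a : R, |hatLinear he a - f| ≤ ε • 1 := by
  obtain ⟨n, hn⟩ := f.exists_openIoo_eq_top he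
  obtain ⟨N, hN⟩ := exists_nat_ge (2 * n / ε)
  rw [div_le_iff₀ hε] at hN
  -- the thresholds, shifted so that the one preceding `-n` has index `0`
  let r (k : ℕ) : ℝ := -n + (k - 1) * ε
  have hr (k : ℕ) : r (k + 1) = r k + ε := by simp only [r]; push_cast; ring
  have hlt (k : ℕ) : r k < r (k + 1) := by rw [hr]; linarith
  choose b hb0 hbe hbu hbv using fun j : ℕ =>
    exists_split he (f.openIoi_sup_openIio (hlt (j + 1)))
  let c (k : ℕ) : LocReal (Spectrum e) := push f.frameMap (truncate (r k))
  let B : R := ∑ j ∈ Finset.range N, ε • b j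
  have hupper : hatLinear he B ≤ c N - c 0 := by
    rw [map_sum, ← Finset.sum_range_sub c]
    refine Finset.sum_le_sum fun j _ => (hatLinear_le_ramp he hε (hbe j) (hbu j)).trans_eq ?_
    rw [push_sub, hr j, add_sub_cancel_right]
  have hlower : c (N + 2) - c 2 ≤ hatLinear he B := by
    rw [map_sum, ← zero_add 2, ← add_assoc, add_zero,
      ← Finset.sum_range_sub (fun k => c (k + (0 + 2)))]
    refine Finset.sum_le_sum fun j _ => le_trans (le_of_eq ?_)
      (ramp_le_hatLinear he hε (hb0 j) (hbv j))
    rw [push_sub, ← hr]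
  refine ⟨B - (n : ℝ) • e, ?_⟩
  rw [map_sub, map_smul, hatLinear_unit]
  refine sup_le ?_ ?_
  · refine (sub_le_sub_right (sub_le_sub_right hupper _) _).trans ?_
    conv_lhs => rw [← push_id f]
    simp only [c, push_one f.frameMap, push_smul, push_sub]
    refine push_le_push_of_eq_top hn fun x hx => ?_
    have h1 : -(n : ℝ) < x := hx.1
    have h2 : r 0 = -n - ε := by simp only [r]; push_cast; ring
    have h3 : min x (r 0) = r 0 := min_eq_right (by linarith)
    have h4 := min_le_left x (r N)
    simp only [ContinuousMap.sub_apply, truncate_apply, ContinuousMap.smul_apply,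
      ContinuousMap.one_apply, smul_eq_mul, ContinuousMap.id_apply]
    linarith
  · rw [neg_sub]
    refine (sub_le_sub_left (sub_le_sub_right hlower _) _).trans ?_
    conv_lhs => rw [← push_id f]
    simp only [c, push_one f.frameMap, push_smul, push_sub]
    refine push_le_push_of_eq_top hn fun x hx => ?_
    have h1 : x < n := hx.2
    have h2 : r 2 = -n + ε := by simp only [r]; push_cast; ring
    have h3 : r (N + 2) = -n + N * ε + ε := by simp only [r]; push_cast; ring
    have h4 : min x (r (N + 2)) = x := min_eq_left (by linarith)
    have h5 := min_le_right x (r 2)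
    simp only [ContinuousMap.sub_apply, truncate_apply, ContinuousMap.smul_apply,
      ContinuousMap.one_apply, smul_eq_mul, ContinuousMap.id_apply]
    linarith

end Density

end StoneYosida

open StoneYosida in
theorem mainTheorem4 {R : Type*} [AddCommGroup R] [Lattice R] [IsOrderedAddMonoid R]
    [Module ℝ R] [IsOrderedModule ℝ R] (e : R) (he : StoneYosida.IsStrongUnit e) :
    StoneYosida.IsStrongUnit (1 : StoneYosida.LocReal (StoneYosida.Spectrum e)) ∧
    ∃ φ : R →ₗ[ℝ] StoneYosida.LocReal (StoneYosida.Spectrum e),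
      (∀ (a : R) (p q : ℝ), (φ a).frameMap (StoneYosida.openIoo p q) =
        StoneYosida.Spectrum.D e ((a - p • e) ⊓ (q • e - a))) ∧
      (∀ a b : R, φ (a ⊔ b) = φ a ⊔ φ b) ∧
      (∀ a b : R, φ (a ⊓ b) = φ a ⊓ φ b) ∧
      φ e = 1 ∧
      (∀ a : R, StoneYosida.unitNorm 1 (φ a) = StoneYosida.unitNorm e a) ∧
      @Dense _ (StoneYosida.LocReal.uniformTopology (StoneYosida.Spectrum e))
        (Set.range φ) := by
  refine ⟨LocReal.isStrongUnit_one he, hatLinear he, hat_openIoo he, hatLinear_sup he,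
    hatLinear_inf he, hatLinear_unit he, unitNorm_hatLinear he, ?_⟩
  let := LocReal.uniformTopology (Spectrum e)
  refine fun f => mem_closure_iff.2 fun U hU hf => ?_
  obtain ⟨ε, hε, h⟩ := hU f hf
  obtain ⟨a, ha⟩ := exists_abs_hatLinear_sub_le he f hε
  exact ⟨hatLinear he a, h _ ha, a, rfl⟩
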